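/- Lemma 3.1. A line in $\mathbb{C}^d$ (a complex affine line) is called $r$-rich for a finite set $V\subset\mathbb{C}^d$ if it contains at least $r$ points of $V$. For each integer $d\ge 1$ there is a constant $0<K_d\le 32(2d)^d$, depending only on $d$, such that the following holds. Let $V\subset\mathbb{C}^d$ be a set of $n$ points, let $r\ge 4$ be an integer and let $k$ be a real number. (1) Suppose that through each point $v\in V$ there are at least $k$ $r$-rich lines, where $$k\ \ge\ K_d\cdot\frac{n}{r^{d-2}}.$$ Then there exists a nonzero polynomial $f\in\mathbb{C}[x_1,\dots,x_d]$ of (total) degree at most $r-2$ such that $f(v)=0$ for all $v\in V$. (2) If the number of $r$-rich lines through each point $v\in V$ is at least $k$ and at most $8k$, then the same conclusion (a nonzero $f$ of degree at most $r-2$ vanishing on $V$) holds under the weaker inequality $$k\ \ge\ K_d\cdot\frac{n}{r^{d-1}}.$$ -/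

import Mathlib

/-- The set `𝓛_r(V)` of `r`-rich lines of a finite set `V ⊂ ℂ^d`: the (complex, affine) lines
that contain at least `r` points of `V`. -/
def richLines {d : ℕ} (r : ℕ) (V : Finset (Fin d → ℂ)) : Set (AffineSubspace ℂ (Fin d → ℂ)) :=
  {L | Module.finrank ℂ L.direction = 1 ∧ r ≤ {v : Fin d → ℂ | v ∈ V ∧ v ∈ L}.ncard}

/-- For `2 ≤ r` there are finitely many `r`-rich lines, so that counting them with `Set.ncard`
is the usual count. -/
theorem richLines_finite {d r : ℕ} (hr : 2 ≤ r) (V : Finset (Fin d → ℂ)) :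
    (richLines r V).Finite := by
  have hmaps : Set.MapsTo (fun L : AffineSubspace ℂ (Fin d → ℂ) =>
      {v : Fin d → ℂ | v ∈ V ∧ v ∈ L}) (richLines r V) (𝒫 (V : Set (Fin d → ℂ))) :=
    fun L _ v hv => hv.1
  refine Set.Finite.of_injOn hmaps ?_ V.finite_toSet.finite_subsets
  have key : ∀ L ∈ richLines r V,
      L = affineSpan ℂ {v : Fin d → ℂ | v ∈ V ∧ v ∈ L} := by
    intro L hL
    obtain ⟨h1, h2⟩ := hL
    obtain ⟨a, ha, b, hb, hab⟩ := (Set.one_lt_ncard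
      (V.finite_toSet.subset (fun v (hv : v ∈ {v | v ∈ V ∧ v ∈ L}) => hv.1))).1 (by omega)
    have hle : affineSpan ℂ {v : Fin d → ℂ | v ∈ V ∧ v ∈ L} ≤ L :=
      affineSpan_le.2 fun v hv => hv.2
    have ha' := subset_affineSpan ℂ _ ha
    have hb' := subset_affineSpan ℂ _ hb
    refine (AffineSubspace.eq_of_direction_eq_of_nonempty_of_le ?_ ⟨a, ha'⟩ hle).symm
    refine Submodule.eq_of_le_of_finrank_le (AffineSubspace.direction_le hle) ?_
    rw [h1]
    refine Submodule.one_le_finrank_iff.2 fun h0 => ?_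
    have := AffineSubspace.vsub_mem_direction ha' hb'
    rw [h0, Submodule.mem_bot, vsub_eq_zero_iff_eq] at this
    exact hab this
  intro L hL L' hL' h
  rw [key L hL, key L' hL']
  exact congrArg _ h

/-- The number of `r`-rich lines of `V` that pass through the point `v`. -/
noncomputable def numRichLinesThrough {d : ℕ} (r : ℕ) (V : Finset (Fin d → ℂ))
    (v : Fin d → ℂ) : ℕ :=
  {L ∈ richLines r V | v ∈ L}.ncard

/-- There is a nonzero polynomial in `ℂ[x₁, …, x_d]` of total degree at most `D` that vanishes at
every point of `V`. -/
def HasVanishingPoly {d : ℕ} (D : ℕ) (V : Finset (Fin d → ℂ)) : Prop :=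
  ∃ f : MvPolynomial (Fin d) ℂ, f ≠ 0 ∧ f.totalDegree ≤ D ∧ ∀ v ∈ V, MvPolynomial.eval v f = 0

/-! If no nonzero polynomial of degree at most `r - 2` vanishes on `V`, evaluation on `V` is
injective in these degrees, so its image has dimension at least about `(r / 2d) ^ d`. On a line,
however, such polynomials satisfy a linear relation with nonzero coefficients at any `r` points.
Cutting the rich lines into `r`-point blocks yields a matrix of such relations whose kernel contains
that image. Its rows have `r` nonzero entries, its columns at least `k`, and two columns share at
most 2 rows. Hence its kernel has dimension at most `4 r n / k`, a contradiction for large `k`.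

The kernel bound rests on scaling: once the columns of `B` have squared norm `c` and its rows at
most 1, `Bᴴ * B - c` acts as `-c` on the kernel, while its Frobenius norm is small. -/

/-! ### Kernels of design matrices. -/

open Finset in
/-- A matrix with an eigenspace of dimension `r` and eigenvalue `μ` has squared Frobenius norm at
least `r ‖μ‖²`. -/
theorem Matrix.finrank_mul_sq_norm_le_sum_sq_norm {n : Type*} [Fintype n] (E : Matrix n n ℂ) (μ : ℂ)
    (N : Submodule ℂ (n → ℂ)) (hN : ∀ x ∈ N, E.mulVec x = μ • x) :
    (Module.finrank ℂ N : ℝ) * ‖μ‖ ^ 2 ≤ ∑ j, ∑ l, ‖E j l‖ ^ 2 := by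
  let φ := (WithLp.linearEquiv 2 ℂ (n → ℂ)).symm
  let N' : Submodule ℂ (EuclideanSpace ℂ n) := N.map φ.toLinearMap
  have hdim : Module.finrank ℂ N' = Module.finrank ℂ N := LinearEquiv.finrank_map_eq φ N
  let e := stdOrthonormalBasis ℂ N'
  have hv : Orthonormal ℂ (fun i => (e i : EuclideanSpace ℂ n)) :=
    e.orthonormal.comp_linearIsometry N'.subtypeₗᵢ
  have hmem : ∀ i, (fun j => (e i : EuclideanSpace ℂ n) j) ∈ N := by
    intro i
    obtain ⟨x, hx, hxe⟩ := (e i).2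
    have : (fun j => (e i : EuclideanSpace ℂ n) j) = x := by
      rw [← hxe]; rfl
    rwa [this]
  have hrow : ∀ j, ∑ i, ‖μ * (e i : EuclideanSpace ℂ n) j‖ ^ 2 ≤ ∑ l, ‖E j l‖ ^ 2 := by
    intro j
    have h := hv.sum_inner_products_le (s := univ) (x := WithLp.toLp 2 (fun l => star (E j l)))
    rw [EuclideanSpace.norm_sq_eq] at h
    simp only [norm_star] at h
    refine le_trans (le_of_eq (sum_congr rfl fun i _ => ?_)) h
    have h1 := congrFun (hN _ (hmem i)) j
    simp only [Matrix.mulVec, dotProduct, Pi.smul_apply, smul_eq_mul] at h1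
    rw [← h1, ← norm_inner_symm, PiLp.inner_apply]
    simp [mul_comm]
  calc (Module.finrank ℂ N : ℝ) * ‖μ‖ ^ 2
      = ∑ i, ‖μ‖ ^ 2 * ‖(e i : EuclideanSpace ℂ n)‖ ^ 2 := by
        rw [← hdim]
        simp [hv.1]
    _ = ∑ i, ∑ j, ‖μ * (e i : EuclideanSpace ℂ n) j‖ ^ 2 := by
        refine sum_congr rfl fun i _ => ?_
        rw [EuclideanSpace.norm_sq_eq, mul_sum]
        simp [mul_pow]
    _ = ∑ j, ∑ i, ‖μ * (e i : EuclideanSpace ℂ n) j‖ ^ 2 := sum_comm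
    _ ≤ _ := sum_le_sum fun j _ => hrow j

open Finset Matrix in
/-- If the columns of `B` have squared norm `c`, its rows have squared norm at most `1`, and any
two columns share at most `t` rows, then the kernel of `B` has dimension at most `t n / c`. -/
theorem Matrix.finrank_mul_le_of_normalized {m n : Type*} [Fintype m] [Fintype n]
    (B : Matrix m n ℂ) (t : ℕ) {c : ℝ} (hc : 0 < c) (hrow : ∀ i, ∑ j, ‖B i j‖ ^ 2 ≤ 1)
    (hcol : ∀ j, ∑ i, ‖B i j‖ ^ 2 = c)
    (hpair : ∀ j l, j ≠ l → {i | B i j ≠ 0 ∧ B i l ≠ 0}.ncard ≤ t)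
    (N : Submodule ℂ (n → ℂ)) (hN : ∀ x ∈ N, B.mulVec x = 0) :
    (Module.finrank ℂ N : ℝ) * c ≤ t * Fintype.card n := by
  classical
  have hE := Matrix.finrank_mul_sq_norm_le_sum_sq_norm
    (Bᴴ * B - (c : ℂ) • (1 : Matrix n n ℂ)) (-c) N (by
      intro x hx
      rw [Matrix.sub_mulVec, ← Matrix.mulVec_mulVec, hN x hx, Matrix.smul_mulVec]
      simp)
  have hentry : ∀ j l, ‖(Bᴴ * B - (c : ℂ) • (1 : Matrix n n ℂ)) j l‖ ^ 2 ≤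
      t * ∑ i, ‖B i j‖ ^ 2 * ‖B i l‖ ^ 2 := by
    intro j l
    by_cases hjl : j = l
    · subst hjl
      have : (Bᴴ * B - (c : ℂ) • (1 : Matrix n n ℂ)) j j = 0 := by
        simp only [Matrix.sub_apply, Matrix.mul_apply, Matrix.conjTranspose_apply,
          Matrix.smul_apply, Matrix.one_apply_eq, ← hcol j]
        push_cast
        simp [← Complex.conj_mul']
      rw [this]
      simp only [norm_zero, ne_eq, OfNat.ofNat_ne_zero, not_false_eq_true, zero_pow]
      positivity
    -- Off the diagonal an entry is a sum of at most `t` nonzero terms, so Cauchy–Schwarz costs only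
    -- a factor `t`.
    · have hs : (Bᴴ * B - (c : ℂ) • (1 : Matrix n n ℂ)) j l =
          ∑ i with B i j ≠ 0 ∧ B i l ≠ 0, star (B i j) * B i l := by
        rw [sum_filter_of_ne]
        · simp [Matrix.mul_apply, Matrix.one_apply_ne hjl]
        · intro i _ hi
          constructor <;> rintro h <;> simp [h] at hi
      have hcard : #{i | B i j ≠ 0 ∧ B i l ≠ 0} ≤ t := by
        have := hpair j l hjl
        rwa [Set.ncard_eq_toFinset_card', Set.toFinset_ofPred] at this
      rw [hs]
      calc _ ≤ (∑ i with B i j ≠ 0 ∧ B i l ≠ 0, ‖star (B i j) * B i l‖) ^ 2 := by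
            gcongr; exact norm_sum_le _ _
        _ ≤ _ := sq_sum_le_card_mul_sum_sq
        _ ≤ t * ∑ i, ‖star (B i j) * B i l‖ ^ 2 := by
            gcongr; exact subset_univ _
        _ = _ := by simp [mul_pow]
  have hsum : ∑ j, ∑ l, ‖(Bᴴ * B - (c : ℂ) • (1 : Matrix n n ℂ)) j l‖ ^ 2 ≤
      t * (Fintype.card n * c) := by
    calc _ ≤ ∑ j, ∑ l, t * ∑ i, ‖B i j‖ ^ 2 * ‖B i l‖ ^ 2 :=
          sum_le_sum fun j _ => sum_le_sum fun l _ => hentry j l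
      _ = t * ∑ j, ∑ i, ‖B i j‖ ^ 2 * ∑ l, ‖B i l‖ ^ 2 := by
          simp_rw [← mul_sum]
          congr 1
          refine sum_congr rfl fun j _ => ?_
          rw [sum_comm]
          simp_rw [mul_sum]
      _ ≤ t * ∑ j, ∑ i, ‖B i j‖ ^ 2 * 1 := by
          gcongr with j _ i _
          exact hrow i
      _ = _ := by simp [hcol]
  have h := hE.trans hsum
  rw [norm_neg, Complex.norm_of_nonneg hc.le] at h
  refine le_of_mul_le_mul_right ?_ hc
  calc _ = (Module.finrank ℂ N : ℝ) * c ^ 2 := by ring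
    _ ≤ _ := h
    _ = _ := by ring

open Finset Filter in
/-- Column weights `exp (y j)` that equalize the column sums of the nonnegative matrix `b` once
every row is divided by one plus its weighted sum. -/
theorem exists_column_scaling {m n : Type*} [Fintype m] [Fintype n] (b : m → n → ℝ)
    (hb : ∀ i j, 0 ≤ b i j) (q : ℕ) {k c : ℝ} (hc : 0 < c) (hck : c * q < k)
    (hrow : ∀ i, {j | b i j ≠ 0}.ncard ≤ q) (hcol : ∀ j, k ≤ {i | b i j ≠ 0}.ncard) :
    ∃ y : n → ℝ, ∀ j,
      ∑ i, b i j * Real.exp (y j) / (1 + ∑ l, b i l * Real.exp (y l)) = c := by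
  classical
  let S : (n → ℝ) → m → ℝ := fun y i => ∑ l, b i l * Real.exp (y l)
  -- The partial derivative of `F` in `y j` is `c` minus the `j`-th scaled column sum, so any
  -- maximum point solves the problem.
  let F : (n → ℝ) → ℝ := fun y => c * ∑ j, y j - ∑ i, Real.log (1 + S y i)
  have hS : ∀ y i, 0 ≤ S y i := fun y i =>
    sum_nonneg fun l _ => mul_nonneg (hb i l) (Real.exp_pos _).le
  have hF : Continuous F := by
    have : ∀ i, Continuous fun y => Real.log (1 + S y i) := by
      intro i
      refine Continuous.log (by fun_prop) fun y => ?_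
      have := hS y i
      positivity
    fun_prop
  have hmax : ∃ y, ∀ z, F z ≤ F y := by
    rcases isEmpty_or_nonempty n with hn | ⟨⟨j₀⟩⟩
    · exact ⟨0, fun z => le_of_eq (congrArg F (Subsingleton.elim _ _))⟩
    have hq : (0 : ℝ) < q := by
      refine Nat.cast_pos.2 (Nat.pos_of_ne_zero fun h0 => ?_)
      subst h0
      have h1 : {i | b i j₀ ≠ 0} = ∅ := by
        rw [Set.eq_empty_iff_forall_notMem]
        intro i hi
        have := (Set.ncard_eq_zero (Set.toFinite _)).1 (Nat.le_zero.1 (hrow i))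
        exact Set.eq_empty_iff_forall_notMem.1 this j₀ hi
      have := hcol j₀
      rw [h1] at this
      simp at this hck
      linarith
    -- The slopes of `c q y - k max(0, y)` are `c q` for negative `y` and `c q - k` for positive
    -- `y`; `ε` is the smaller decay rate, which makes `F` tend to `-∞`.
    let ε := min (c * q) (k - c * q)
    have hε : 0 < ε := lt_min (by positivity) (by linarith)
    let C : ℝ := ∑ i, ∑ j with b i j ≠ 0, |Real.log (b i j)|
    have hbound : ∀ y, F y ≤ (C - ε * ‖y‖) / q := by
      intro y
      have hterm : ∀ i j, b i j ≠ 0 →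
          max 0 (y j) - |Real.log (b i j)| ≤ Real.log (1 + S y i) := by
        intro i j hij
        have hpos : 0 < b i j := lt_of_le_of_ne (hb i j) (Ne.symm hij)
        have h0 : 0 ≤ Real.log (1 + S y i) := Real.log_nonneg (by linarith [hS y i])
        have h1 : Real.log (b i j) + y j ≤ Real.log (1 + S y i) := by
          rw [← Real.log_exp (y j), ← Real.log_mul hpos.ne' (Real.exp_pos _).ne']
          refine Real.log_le_log (mul_pos hpos (Real.exp_pos _)) ?_
          have := single_le_sum (f := fun l => b i l * Real.exp (y l))
            (fun l _ => mul_nonneg (hb i l) (Real.exp_pos _).le) (mem_univ j)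
          simp only [S]
          linarith
        rcases max_cases 0 (y j) with h | h
        · rw [h.1]; linarith [abs_nonneg (Real.log (b i j))]
        · rw [h.1]; linarith [neg_abs_le (Real.log (b i j))]
      have hrows : ∀ i, ∑ j with b i j ≠ 0, (max 0 (y j) - |Real.log (b i j)|) ≤
          q * Real.log (1 + S y i) := by
        intro i
        have h0 : 0 ≤ Real.log (1 + S y i) := Real.log_nonneg (by linarith [hS y i])
        have h1 := hrow i
        rw [Set.ncard_eq_toFinset_card', Set.toFinset_ofPred] at h1
        calc _ ≤ ∑ j with b i j ≠ 0, Real.log (1 + S y i) :=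
              sum_le_sum fun j hj => hterm i j (mem_filter.1 hj).2
          _ = #{j | b i j ≠ 0} * Real.log (1 + S y i) := by simp
          _ ≤ _ := by gcongr
      have hcols : k * ∑ j, max 0 (y j) ≤ ∑ i, ∑ j with b i j ≠ 0, max 0 (y j) := by
        simp_rw [sum_filter]
        rw [sum_comm, mul_sum]
        refine sum_le_sum fun j _ => ?_
        rw [← sum_filter, sum_const, nsmul_eq_mul]
        have h1 := hcol j
        rw [Set.ncard_eq_toFinset_card', Set.toFinset_ofPred] at h1
        gcongr
      have htot : k * ∑ j, max 0 (y j) - C ≤ q * ∑ i, Real.log (1 + S y i) := by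
        have := sum_le_sum fun i (_ : i ∈ univ) => hrows i
        simp only [sum_sub_distrib, ← mul_sum] at this
        linarith
      have hj : ∀ j, c * q * y j - k * max 0 (y j) ≤ - ε * |y j| := by
        intro j
        have h1 : ε ≤ c * q := min_le_left _ _
        have h2 : ε ≤ k - c * q := min_le_right _ _
        rcases le_total 0 (y j) with h | h
        · rw [max_eq_right h, abs_of_nonneg h]; nlinarith
        · rw [max_eq_left h, abs_of_nonpos h]; nlinarith
      have hnorm : ‖y‖ ≤ ∑ j, |y j| := by
        refine (pi_norm_le_iff_of_nonneg (sum_nonneg fun _ _ => abs_nonneg _)).2 fun j => ?_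
        exact single_le_sum (f := fun j => |y j|) (fun _ _ => abs_nonneg _) (mem_univ j)
      have hjs := sum_le_sum fun j (_ : j ∈ univ) => hj j
      rw [sum_sub_distrib, ← mul_sum, ← mul_sum, ← mul_sum] at hjs
      rw [le_div_iff₀ hq]
      have := mul_le_mul_of_nonneg_left hnorm hε.le
      have hFy : F y * q = c * q * ∑ j, y j - q * ∑ i, Real.log (1 + S y i) := by
        simp only [F]; ring
      linarith
    refine hF.exists_forall_ge (tendsto_atBot_mono hbound ?_)
    refine Tendsto.atBot_div_const hq ?_
    simp_rw [sub_eq_add_neg]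
    refine tendsto_atBot_add_const_left _ _ ?_
    exact tendsto_neg_atTop_atBot.comp
      ((tendsto_norm_cocompact_atTop (E := n → ℝ)).const_mul_atTop hε)
  obtain ⟨y, hy⟩ := hmax
  refine ⟨y, fun j => ?_⟩
  have hcoord : ∀ l, HasDerivAt (fun s : ℝ => (y + s • (Pi.single j 1 : n → ℝ)) l)
      ((Pi.single j 1 : n → ℝ) l) 0 := by
    intro l
    simpa using ((hasDerivAt_id (0 : ℝ)).mul_const ((Pi.single j 1 : n → ℝ) l)).const_add (y l)
  have hder : HasDerivAt (fun s : ℝ => F (y + s • Pi.single j 1))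
      (c * ∑ l, (Pi.single j 1 : n → ℝ) l -
        ∑ i, (∑ l, b i l * (Real.exp (y l) * (Pi.single j 1 : n → ℝ) l)) / (1 + S y i)) 0 := by
    refine HasDerivAt.sub (HasDerivAt.const_mul _ (HasDerivAt.fun_sum fun l _ => hcoord l))
      (HasDerivAt.fun_sum fun i _ => ?_)
    have hSi : HasDerivAt (fun s : ℝ => 1 + S (y + s • Pi.single j 1) i)
        (∑ l, b i l * (Real.exp (y l) * (Pi.single j 1 : n → ℝ) l)) 0 := by
      refine HasDerivAt.const_add _ (HasDerivAt.fun_sum fun l _ => HasDerivAt.const_mul _ ?_)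
      simpa using (hcoord l).exp
    have := hSi.log (by have := hS (y + (0 : ℝ) • Pi.single j 1) i; positivity)
    simpa using this
  have hmaxloc : IsLocalMax (fun s : ℝ => F (y + s • Pi.single j 1)) 0 :=
    Eventually.of_forall fun s => by simpa using hy (y + s • Pi.single j 1)
  have h0 := hmaxloc.hasDerivAt_eq_zero hder
  simp only [Pi.single_apply, mul_ite, mul_one, mul_zero, sum_ite_eq', mem_univ, if_true] at h0
  simp only [S] at h0
  linarith

open Finset in
/-- The kernel of a `(q, k, t)`-design matrix with `n` columns has dimension at most
`2 t q n / k`. -/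
theorem Matrix.finrank_mul_le_of_design {m n : Type*} [Fintype m] [Fintype n]
    (A : Matrix m n ℂ) (q t : ℕ) {k : ℝ} (hk : 0 < k) (hq : 0 < q)
    (hrow : ∀ i, {j | A i j ≠ 0}.ncard ≤ q) (hcol : ∀ j, k ≤ {i | A i j ≠ 0}.ncard)
    (hpair : ∀ j l, j ≠ l → {i | A i j ≠ 0 ∧ A i l ≠ 0}.ncard ≤ t)
    (N : Submodule ℂ (n → ℂ)) (hN : ∀ x ∈ N, A.mulVec x = 0) :
    (Module.finrank ℂ N : ℝ) * k ≤ 2 * t * q * Fintype.card n := by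
  have hq' : (0 : ℝ) < q := Nat.cast_pos.2 hq
  -- Half of the threshold `k / q`, to make `c q < k` strict; this is the source of the factor 2 in
  -- the bound.
  have hc : 0 < k / (2 * q) := by positivity
  obtain ⟨y, hy⟩ := exists_column_scaling (fun i j => ‖A i j‖ ^ 2) (fun i j => by positivity) q hc
    (k := k) (by field_simp; norm_num) (by simpa using hrow) (by simpa using hcol)
  let S : m → ℝ := fun i => ∑ l, ‖A i l‖ ^ 2 * Real.exp (y l)
  have hS : ∀ i, 0 ≤ S i := fun i => by positivity
  let u : n → ℂ := fun j => (Real.exp (y j / 2) : ℂ)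
  have hu : ∀ j, u j ≠ 0 := fun j => by
    simp only [u]; exact_mod_cast (Real.exp_pos _).ne'
  let w : m → ℂ := fun i => (((Real.sqrt (1 + S i))⁻¹ : ℝ) : ℂ)
  have hw : ∀ i, w i ≠ 0 := fun i => by
    have := hS i
    simp only [w]
    norm_cast
    positivity
  let B : Matrix m n ℂ := fun i j => w i * (A i j * u j)
  have hB0 : ∀ i j, B i j ≠ 0 ↔ A i j ≠ 0 := fun i j => by simp [B, hu, hw]
  have hB : ∀ i j, ‖B i j‖ ^ 2 = ‖A i j‖ ^ 2 * Real.exp (y j) / (1 + S i) := by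
    intro i j
    have h1 : 0 ≤ 1 + S i := by linarith [hS i]
    simp only [B, w, u, norm_mul, Complex.norm_real, Real.norm_eq_abs, mul_pow, sq_abs, inv_pow,
      Real.sq_sqrt h1]
    rw [← Real.exp_nat_mul, Nat.cast_ofNat, show 2 * (y j / 2) = y j by ring]
    exact (div_eq_inv_mul _ _).symm
  let D : (n → ℂ) ≃ₗ[ℂ] (n → ℂ) :=
    LinearEquiv.piCongrRight fun j => LinearEquiv.smulOfUnit (Units.mk0 _ (inv_ne_zero (hu j)))
  have hmain := B.finrank_mul_le_of_normalized t hc (fun i => ?_) (fun j => ?_)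
    (by simpa only [hB0] using hpair) (N.map D.toLinearMap) ?_
  · rw [LinearEquiv.finrank_map_eq D N] at hmain
    rw [mul_div_assoc', div_le_iff₀ (by positivity)] at hmain
    linarith
  · simp_rw [hB]
    rw [← sum_div, div_le_one (by linarith [hS i])]
    simp only [S]
    linarith
  · simp_rw [hB]
    exact hy j
  · rintro _ ⟨x, hx, rfl⟩
    ext i
    have h1 := congrFun (hN x hx) i
    simp only [Matrix.mulVec, dotProduct, Pi.zero_apply] at h1 ⊢
    rw [← mul_zero (w i), ← h1, mul_sum]
    refine sum_congr rfl fun j _ => ?_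
    have h2 : (D.toLinearMap x) j = (u j)⁻¹ * x j := rfl
    rw [h2]
    simp only [B]
    field_simp [hu j]

/-! ### Blocks on lines and evaluations of polynomials. -/

open Finset in
/-- A set of at least `r` elements is covered by `r`-element subsets, such that every element is in
at most two of them. -/
theorem Finset.exists_blocks {α : Type*} [DecidableEq α] {r : ℕ} (hr : 0 < r) (S : Finset α)
    (hS : r ≤ #S) :
    ∃ P : Finset (Finset α), (∀ b ∈ P, b ⊆ S ∧ #b = r) ∧ (∀ a ∈ S, ∃ b ∈ P, a ∈ b) ∧
      ∀ a, #{b ∈ P | a ∈ b} ≤ 2 := by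
  induction S using Finset.strongInduction with
  | H S ih =>
    obtain ⟨b₁, hb₁, hc₁⟩ := exists_subset_card_eq hS
    have hsd : #(S \ b₁) = #S - r := by rw [card_sdiff_of_subset hb₁, hc₁]
    -- Up to `2 r` elements, two possibly overlapping blocks suffice; otherwise a block is split off
    -- disjointly from the rest.
    rcases le_total #S (2 * r) with h | h
    · obtain ⟨b₂, hb₂, hbS, hc₂⟩ := exists_subsuperset_card_eq (n := r)
        (sdiff_subset : S \ b₁ ⊆ S) (by omega) hS
      refine ⟨{b₁, b₂}, by simp [*], fun a ha => ?_, fun a => ?_⟩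
      · by_cases hab : a ∈ b₁
        · exact ⟨b₁, by simp, hab⟩
        · exact ⟨b₂, by simp, hb₂ (mem_sdiff.2 ⟨ha, hab⟩)⟩
      · exact (card_filter_le _ _).trans card_le_two
    · have hb₁0 : b₁.Nonempty := card_pos.1 (by omega)
      obtain ⟨P, hP, hcov, htwo⟩ := ih (S \ b₁) (sdiff_ssubset hb₁ hb₁0) (by omega)
      refine ⟨insert b₁ P, ?_, fun a ha => ?_, fun a => ?_⟩
      · intro b hb
        rcases mem_insert.1 hb with rfl | hb
        · exact ⟨hb₁, hc₁⟩
        · exact ⟨(hP b hb).1.trans sdiff_subset, (hP b hb).2⟩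
      · by_cases hab : a ∈ b₁
        · exact ⟨b₁, by simp, hab⟩
        · obtain ⟨b, hb, hab⟩ := hcov a (mem_sdiff.2 ⟨ha, hab⟩)
          exact ⟨b, by simp [hb], hab⟩
      · by_cases hab : a ∈ b₁
        · have : {b ∈ P | a ∈ b} = ∅ := by
            refine filter_eq_empty_iff.2 fun b hb hab' => ?_
            exact (mem_sdiff.1 ((hP b hb).1 hab')).2 hab
          rw [filter_insert, if_pos hab, this]
          simp
        · rw [filter_insert, if_neg hab]
          exact htwo a

/-- The restriction of a polynomial to a parametrized line. -/
theorem MvPolynomial.exists_natDegree_le_eval_line {σ : Type*} {D : ℕ} (f : MvPolynomial σ ℂ)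
    (hf : f.totalDegree ≤ D) (p u : σ → ℂ) :
    ∃ g : Polynomial ℂ, g.natDegree ≤ D ∧ ∀ τ, g.eval τ = MvPolynomial.eval (p + τ • u) f := by
  refine ⟨MvPolynomial.aeval (fun i => Polynomial.C (p i) + Polynomial.X * Polynomial.C (u i)) f,
    ?_, fun τ => ?_⟩
  · have := MvPolynomial.aeval_natDegree_le f hf
      (fun i => Polynomial.C (p i) + Polynomial.X * Polynomial.C (u i)) (n := 1)
      (fun i => by compute_degree)
    simpa only [mul_one] using this
  · rw [← Polynomial.coe_evalRingHom, MvPolynomial.map_aeval]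
    simp only [MvPolynomial.coe_eval₂Hom, MvPolynomial.eval₂_eq, MvPolynomial.eval_eq]
    simp [mul_comm τ]

open Finset in
/-- The evaluations of polynomials of degree at most `D` at more than `D + 1` points of a line
satisfy a linear relation with nonzero coefficients. -/
theorem exists_relation_of_finrank_direction_eq_one {d D : ℕ} {L : AffineSubspace ℂ (Fin d → ℂ)}
    (hL : Module.finrank ℂ L.direction = 1) {b : Finset (Fin d → ℂ)} (hbL : ∀ v ∈ b, v ∈ L)
    (hb : D + 2 ≤ #b) :
    ∃ a : (Fin d → ℂ) → ℂ, (∀ v ∈ b, a v ≠ 0) ∧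
      ∀ f : MvPolynomial (Fin d) ℂ, f.totalDegree ≤ D →
        ∑ v ∈ b, a v * MvPolynomial.eval v f = 0 := by
  classical
  obtain ⟨p, hp⟩ : b.Nonempty := card_pos.1 (by omega)
  obtain ⟨⟨u, hu⟩, -, hspan⟩ := finrank_eq_one_iff'.1 hL
  have hτ : ∀ v, ∃ τ : ℂ, v ∈ b → v = p + τ • u := by
    intro v
    by_cases hv : v ∈ b
    · obtain ⟨τ, hτ⟩ := hspan ⟨v -ᵥ p, AffineSubspace.vsub_mem_direction (hbL v hv) (hbL p hp)⟩
      refine ⟨τ, fun _ => ?_⟩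
      have := congrArg Subtype.val hτ
      simp only [Submodule.coe_smul, vsub_eq_sub] at this
      rw [this]; simp
    · exact ⟨0, fun h => absurd h hv⟩
  choose τ hτ using hτ
  have hinj : Set.InjOn τ b := by
    intro v hv w hw h
    rw [hτ v hv, hτ w hw, h]
  -- Lagrange weights: the sum is the coefficient of degree `#b - 1 > D` of the restriction to the
  -- line, hence zero.
  refine ⟨fun v => (∏ w ∈ b.erase v, (τ v - τ w))⁻¹, fun v hv => ?_, fun f hf => ?_⟩
  · refine inv_ne_zero (prod_ne_zero_iff.2 fun w hw => sub_ne_zero.2 fun h => ?_)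
    exact (mem_erase.1 hw).1 (hinj hv (mem_of_mem_erase hw) h).symm
  · obtain ⟨g, hdeg, heval⟩ := f.exists_natDegree_le_eval_line hf p u
    have h1 := Lagrange.coeff_eq_sum hinj (P := g) (by
      refine lt_of_le_of_lt Polynomial.degree_le_natDegree ?_
      exact_mod_cast (by omega : g.natDegree < #b))
    rw [Polynomial.coeff_eq_zero_of_natDegree_lt (by omega)] at h1
    rw [h1]
    refine sum_congr rfl fun v hv => ?_
    rw [heval, ← hτ v hv, div_eq_inv_mul]

/-- Two distinct points lie on at most one line. -/
theorem AffineSubspace.eq_of_finrank_direction_eq_one {V : Type*} [AddCommGroup V] [Module ℂ V]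
    {L L' : AffineSubspace ℂ V} (hL : Module.finrank ℂ L.direction = 1)
    (hL' : Module.finrank ℂ L'.direction = 1) {x y : V} (hxy : x ≠ y) (hx : x ∈ L) (hy : y ∈ L)
    (hx' : x ∈ L') (hy' : y ∈ L') : L = L' := by
  have hx0 : y -ᵥ x ≠ 0 := by simpa using fun h => hxy (sub_eq_zero.1 h).symm
  have key : ∀ M : AffineSubspace ℂ V, Module.finrank ℂ M.direction = 1 → x ∈ M → y ∈ M →
      M.direction = Submodule.span ℂ {y -ᵥ x} := by
    intro M hM hxM hyM
    have : FiniteDimensional ℂ M.direction := Module.finite_of_finrank_eq_succ hM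
    refine (Submodule.eq_of_le_of_finrank_le ?_ ?_).symm
    · rw [Submodule.span_singleton_le_iff_mem]
      exact AffineSubspace.vsub_mem_direction hyM hxM
    · rw [hM, finrank_span_singleton hx0]
  exact AffineSubspace.ext_of_direction_eq ((key L hL hx hy).trans (key L' hL' hx' hy').symm)
    ⟨x, hx, hx'⟩

open Finset in
/-- If no nonzero polynomial of degree at most `D` vanishes on `V`, the restrictions to `V` of
polynomials of degree at most `D` contain a space of dimension `(D / d + 1) ^ d`. -/
theorem exists_evaluation_submodule {d D : ℕ} {V : Finset (Fin d → ℂ)}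
    (hV : ¬ HasVanishingPoly D V) :
    ∃ N : Submodule ℂ (V → ℂ), Module.finrank ℂ N = (D / d + 1) ^ d ∧
      ∀ x ∈ N, ∃ f : MvPolynomial (Fin d) ℂ, f.totalDegree ≤ D ∧
        ∀ v, x v = MvPolynomial.eval v.1 f := by
  classical
  -- Only monomials with every exponent at most `D / d` are used: they are easy to count and have
  -- degree at most `D`.
  let e : (Fin d → Fin (D / d + 1)) → (Fin d →₀ ℕ) := fun s =>
    Finsupp.equivFunOnFinite.symm fun i => (s i : ℕ)
  have he : Function.Injective e := by
    intro s s' h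
    ext i
    exact DFunLike.congr_fun h i
  let T : ((Fin d → Fin (D / d + 1)) → ℂ) →ₗ[ℂ] MvPolynomial (Fin d) ℂ :=
    ∑ s, (MvPolynomial.monomial (e s)).comp (LinearMap.proj s)
  have hT : ∀ x, T x = ∑ s, MvPolynomial.monomial (e s) (x s) := fun x => by simp [T]
  have hcoeff : ∀ x s, (T x).coeff (e s) = x s := by
    intro x s
    rw [hT, MvPolynomial.coeff_sum]
    simp [MvPolynomial.coeff_monomial, he.eq_iff]
  have hdeg : ∀ x, (T x).totalDegree ≤ D := by
    intro x
    rw [hT]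
    refine MvPolynomial.totalDegree_finsetSum_le fun s _ => ?_
    refine (MvPolynomial.totalDegree_monomial_le _ _).trans ?_
    rw [Finsupp.sum_fintype _ _ (fun _ => rfl)]
    calc ∑ i, (e s) i ≤ ∑ _i : Fin d, D / d := sum_le_sum fun i _ => Nat.lt_succ_iff.1 (s i).2
      _ = d * (D / d) := by simp
      _ ≤ D := Nat.mul_div_le D d
  let R : MvPolynomial (Fin d) ℂ →ₗ[ℂ] (V → ℂ) :=
    LinearMap.pi fun v => (MvPolynomial.aeval (R := ℂ) v.1).toLinearMap
  have hR : ∀ f v, R f v = MvPolynomial.eval v.1 f := fun f v => by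
    simp [R]
  have hinj : Function.Injective (R.comp T) := by
    rw [← LinearMap.ker_eq_bot, LinearMap.ker_eq_bot']
    intro x hx
    by_contra hx0
    refine hV ⟨T x, fun h => hx0 ?_, hdeg x, fun v hv => ?_⟩
    · ext s
      rw [← hcoeff x s, h]; simp
    · rw [← hR (T x) ⟨v, hv⟩]
      exact congrFun hx ⟨v, hv⟩
  refine ⟨LinearMap.range (R.comp T), ?_, ?_⟩
  · rw [LinearMap.finrank_range_of_inj hinj]
    simp
  · rintro _ ⟨x, rfl⟩
    exact ⟨T x, hdeg x, fun v => hR _ v⟩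

/-! ### The matrix of relations on rich lines. -/

open Finset in
/-- If at least `k` rich lines pass through every point of `V`, and `k` is large enough, then a
nonzero polynomial of degree at most `r - 2` vanishes on `V`. -/
theorem hasVanishingPoly_of_le_numRichLinesThrough {d r : ℕ} (hr : 2 ≤ r)
    {V : Finset (Fin d → ℂ)} {k : ℝ} (hk : 0 < k)
    (hV : ∀ v ∈ V, k ≤ numRichLinesThrough r V v)
    (hlt : 4 * r * (#V : ℝ) < (((r - 2) / d + 1) ^ d : ℕ) * k) :
    HasVanishingPoly (r - 2) V := by
  classical
  by_contra hnot
  obtain ⟨N, hdim, hN⟩ := exists_evaluation_submodule hnot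
  have hblocks : ∀ L : AffineSubspace ℂ (Fin d → ℂ), ∃ P : Finset (Finset (Fin d → ℂ)),
      L ∈ richLines r V → (∀ b ∈ P, (b ⊆ V ∧ ∀ v ∈ b, v ∈ L) ∧ #b = r) ∧
        (∀ v ∈ V, v ∈ L → ∃ b ∈ P, v ∈ b) ∧ ∀ v, #{b ∈ P | v ∈ b} ≤ 2 := by
    intro L
    by_cases hL : L ∈ richLines r V
    · have hcard : r ≤ #{v ∈ V | v ∈ L} := by
        have h := hL.2
        rwa [← Finset.coe_filter, Set.ncard_coe_finset] at h
      obtain ⟨P, h1, h2, h3⟩ := exists_blocks (by omega) _ hcard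
      refine ⟨P, fun _ => ⟨fun b hb => ⟨⟨fun v hv => ?_, fun v hv => ?_⟩, (h1 b hb).2⟩,
        fun v hv hvL => h2 v (mem_filter.2 ⟨hv, hvL⟩), h3⟩⟩
      · exact (mem_filter.1 ((h1 b hb).1 hv)).1
      · exact (mem_filter.1 ((h1 b hb).1 hv)).2
    · exact ⟨∅, fun h => absurd h hL⟩
  choose P hP using hblocks
  let 𝓑 : Set (Finset (Fin d → ℂ)) := {b | ∃ L ∈ richLines r V, b ∈ P L}
  have hfin : 𝓑.Finite := by
    refine V.powerset.finite_toSet.subset ?_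
    rintro b ⟨L, hL, hb⟩
    exact mem_coe.2 (mem_powerset.2 (((hP L hL).1 b hb).1.1))
  have : Fintype 𝓑 := hfin.fintype
  choose ℓ hℓ hbℓ using fun b : 𝓑 => b.2
  have hline : ∀ (b : 𝓑) (L : AffineSubspace ℂ (Fin d → ℂ)), L ∈ richLines r V → ∀ x ∈ b.1,
      ∀ y ∈ b.1, x ≠ y → x ∈ L → y ∈ L → ℓ b = L := by
    intro b L hL x hx y hy hxy hxL hyL
    have h := ((hP _ (hℓ b)).1 b (hbℓ b)).1.2
    exact AffineSubspace.eq_of_finrank_direction_eq_one (hℓ b).1 hL.1 hxy (h x hx) (h y hy) hxL hyL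
  have hrel : ∀ b : 𝓑, ∃ a : (Fin d → ℂ) → ℂ, (∀ v ∈ b.1, a v ≠ 0) ∧
      ∀ f : MvPolynomial (Fin d) ℂ, f.totalDegree ≤ r - 2 →
        ∑ v ∈ b.1, a v * MvPolynomial.eval v f = 0 := by
    intro b
    have h := (hP _ (hℓ b)).1 b (hbℓ b)
    exact exists_relation_of_finrank_direction_eq_one (hℓ b).1 h.1.2 (by omega)
  choose a ha0 ha using hrel
  let A : Matrix 𝓑 V ℂ := fun b v => if v.1 ∈ b.1 then a b v.1 else 0
  have hA : ∀ b v, A b v ≠ 0 ↔ v.1 ∈ b.1 := by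
    intro b v
    simp only [A]
    split_ifs with h
    · simp [h, ha0 b v.1 h]
    · simp [h]
  have hmain := A.finrank_mul_le_of_design r 2 hk (by omega) (fun b => ?_) (fun v => ?_)
    (fun v w hvw => ?_) N (fun x hx => ?_)
  · rw [hdim, Fintype.card_coe] at hmain
    push_cast at hmain hlt
    linarith
  · simp only [hA]
    have hc := ((hP _ (hℓ b)).1 b (hbℓ b)).2
    calc _ ≤ (b.1 : Set (Fin d → ℂ)).ncard :=
          Set.ncard_le_ncard_of_injOn Subtype.val (fun v hv => hv) Subtype.val_injective.injOn
      _ = r := by rw [Set.ncard_coe_finset, hc]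
      _ ≤ r := le_rfl
  · simp only [hA]
    refine (hV v v.2).trans (Nat.cast_le.2 ?_)
    -- A block has at least two points and so determines its line; every rich line through `v` thus
    -- comes from a block containing `v`.
    calc numRichLinesThrough r V v ≤ (ℓ '' {b | v.1 ∈ b.1}).ncard := by
          refine Set.ncard_le_ncard ?_ (Set.toFinite _)
          rintro L ⟨hL, hvL⟩
          obtain ⟨b, hb, hvb⟩ := (hP L hL).2.1 v v.2 hvL
          have hbP := (hP L hL).1 b hb
          obtain ⟨w, hw, hwv⟩ := exists_mem_ne (by omega : 1 < #b) v.1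
          exact ⟨⟨b, L, hL, hb⟩, hvb, hline _ L hL w hw v.1 hvb hwv (hbP.1.2 w hw) hvL⟩
      _ ≤ _ := Set.ncard_image_le (Set.toFinite _)
  · simp only [hA]
    rcases Set.eq_empty_or_nonempty {b : 𝓑 | v.1 ∈ b.1 ∧ w.1 ∈ b.1} with h | ⟨b₀, hv₀, hw₀⟩
    · rw [h]; simp
    have h₀ := ((hP _ (hℓ b₀)).1 b₀ (hbℓ b₀)).1.2
    refine le_trans ?_ ((hP _ (hℓ b₀)).2.2 v)
    rw [← Set.ncard_coe_finset]
    refine Set.ncard_le_ncard_of_injOn Subtype.val (fun b hb => ?_) Subtype.val_injective.injOn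
    -- All blocks containing both points lie on one line, whose cover uses `v` at most twice.
    have hb' := hline b _ (hℓ b₀) v hb.1 w hb.2 (fun h => hvw (Subtype.ext h)) (h₀ _ hv₀) (h₀ _ hw₀)
    exact mem_coe.2 (mem_filter.2 ⟨hb' ▸ hbℓ b, hb.1⟩)
  · obtain ⟨f, hf, hxf⟩ := hN x hx
    ext b
    have hbV := ((hP _ (hℓ b)).1 b (hbℓ b)).1.1
    rw [Pi.zero_apply, ← ha b f hf]
    simp only [Matrix.mulVec, dotProduct, A, ite_mul, zero_mul, hxf]
    rw [Finset.sum_coe_sort V fun v => if v ∈ b.1 then a b v * MvPolynomial.eval v f else 0,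
      ← sum_filter, filter_mem_eq_inter, inter_eq_right.2 hbV]

/-! ### Constants and conclusion. -/

theorem pow_le_two_mul_pow_mul_pow {d r : ℕ} (hd : 1 ≤ d) (hr : 2 ≤ r) :
    (r : ℝ) ^ d ≤ (2 * (d : ℝ)) ^ d * (((r - 2) / d + 1) ^ d : ℕ) := by
  rw [Nat.cast_pow, ← mul_pow]
  refine pow_le_pow_left₀ (Nat.cast_nonneg r) ?_ d
  have h := Nat.lt_div_mul_add (a := r - 2) (b := d) hd
  have h2 : r ≤ 2 * d * ((r - 2) / d + 1) := by
    have : 2 * d * ((r - 2) / d + 1) = 2 * ((r - 2) / d * d + d) := by ring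
    omega
  exact_mod_cast h2

theorem hasVanishingPoly_of_le_numRichLinesThrough_of_le {d r : ℕ} (hd : 1 ≤ d) (hr : 2 ≤ r)
    {V : Finset (Fin d → ℂ)} {k : ℝ} (hV : ∀ v ∈ V, k ≤ numRichLinesThrough r V v)
    (hk : 32 * (2 * (d : ℝ)) ^ d * ((V.card : ℝ) / (r : ℝ) ^ ((d : ℤ) - 1)) ≤ k) :
    HasVanishingPoly (r - 2) V := by
  -- For empty `V` the hypothesis does not force `k > 0`.
  rcases V.eq_empty_or_nonempty with rfl | hne
  · exact ⟨1, one_ne_zero, by simp, by simp⟩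
  have hn : (0 : ℝ) < V.card := Nat.cast_pos.2 hne.card_pos
  have hr0 : (0 : ℝ) < r := Nat.cast_pos.2 (by omega)
  have hd0 : (0 : ℝ) < d := Nat.cast_pos.2 (by omega)
  have hk0 : 0 < k := lt_of_lt_of_le (by positivity) hk
  refine hasVanishingPoly_of_le_numRichLinesThrough hr hk0 hV ?_
  rw [zpow_sub_one₀ hr0.ne', zpow_natCast, ← div_eq_mul_inv, div_div_eq_mul_div, mul_div_assoc',
    div_le_iff₀ (by positivity)] at hk
  have hpow := mul_le_mul_of_nonneg_left (pow_le_two_mul_pow_mul_pow hd hr) hk0.le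
  have h2 : 0 < (2 * (d : ℝ)) ^ d := by positivity
  refine lt_of_mul_lt_mul_left ?_ h2.le
  -- Positivity makes the passage from 4 to 32 strict.
  have h3 : 0 < (2 * (d : ℝ)) ^ d * (V.card * r) := by positivity
  calc (2 * (d : ℝ)) ^ d * (4 * r * V.card) < 32 * (2 * (d : ℝ)) ^ d * (V.card * r) := by linarith
    _ ≤ _ := hk
    _ ≤ _ := hpow
    _ = _ := by ring

/- The exponents `d - 2` and `d - 1` are integers, so that `r ^ (d - 2)` is `1 / r` for `d = 1`. -/
theorem lemma3p1 (d : ℕ) (hd : 1 ≤ d) :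
    ∃ K : ℝ, 0 < K ∧ K ≤ 32 * (2 * (d : ℝ)) ^ d ∧
      ∀ (V : Finset (Fin d → ℂ)) (r : ℕ), 4 ≤ r → ∀ k : ℝ,
        ((∀ v ∈ V, k ≤ (numRichLinesThrough r V v : ℝ)) →
          K * ((V.card : ℝ) / (r : ℝ) ^ ((d : ℤ) - 2)) ≤ k →
          HasVanishingPoly (r - 2) V) ∧
        ((∀ v ∈ V, k ≤ (numRichLinesThrough r V v : ℝ) ∧
            (numRichLinesThrough r V v : ℝ) ≤ 8 * k) →
          K * ((V.card : ℝ) / (r : ℝ) ^ ((d : ℤ) - 1)) ≤ k →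
          HasVanishingPoly (r - 2) V) := by
  have hd0 : (0 : ℝ) < d := Nat.cast_pos.2 (by omega)
  refine ⟨32 * (2 * (d : ℝ)) ^ d, by positivity, le_rfl, fun V r hr k => ⟨fun hV hk => ?_,
    fun hV hk => hasVanishingPoly_of_le_numRichLinesThrough_of_le hd (by omega)
      (fun v hv => (hV v hv).1) hk⟩⟩
  -- As `r ≥ 1`, the bound with exponent `d - 2` implies the one with `d - 1`.
  refine hasVanishingPoly_of_le_numRichLinesThrough_of_le hd (by omega) hV (le_trans ?_ hk)
  have hr1 : (1 : ℝ) ≤ r := Nat.one_le_cast.2 (by omega)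
  gcongr
  norm_num
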